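/- Let $\alpha_0=x_0,\alpha_1,\dots,\alpha_n$ be nonzero linear forms on $\mathbb C^{\ell+1}$ with pairwise distinct kernels, defining an arrangement of hyperplanes $H_j=\ker\alpha_j$ in $\mathbb P^\ell$. Put $f_j(x_1,\dots,x_\ell)=\alpha_j(1,x_1,\dots,x_\ell)$, so $f_0=1$, and let $U=\{x\in\mathbb C^\ell : f_j(x)\ne 0 \text{ for all } j\}=\mathbb P^\ell-\bigcup_j H_j$. Let $A^1$ be the span of $d\log f_1,\dots,d\log f_n$ in the space of one-forms on $U$. For $\xi\in\mathbb Z^{n+1}$ with $\sum_j\xi_j=0$ put $\omega_\xi=\sum_j \xi_j\,d\log f_j\in A^1$ and $\Phi_\xi=\prod_j f_j^{\xi_j}$. Let $D\subseteq A^1$ be a rational singular subspace: every product of $q=\dim D$ elements of $D$ is zero as a $q$-form on $U$, and $D$ has a basis $\omega_{\xi_1},\dots,\omega_{\xi_q}$ with $\xi_i\in\mathbb Z^{n+1}$, $\sum_j\xi_{ij}=0$. Write $\Lambda=(\xi_1,\dots,\xi_q)$ and let $$\Phi_\Lambda=[1:\Phi_{\xi_1}:\dots:\Phi_{\xi_q}]\colon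 U\to\mathbb P^q,\qquad Y=\Phi_\Lambda(U),$$ with $\bar Y$ the Zariski closure of $Y$ in $\mathbb P^q$. Let $a=(a_0,\dots,a_q)\in\mathbb C^{q+1}$ with $\sum_{i=0}^q a_i=0$, put $\omega_a=\sum_{i=1}^q a_i\omega_{\xi_i}$, and let $\tau_a$ be the restriction to $\bar Y$ of the rational one-form $\sum_{i=0}^q a_i\,d\log z_i$ on $\mathbb P^q$. Let $V(\omega_a)=\{x\in U:\omega_a(x)=0\}$, and let $V(\tau_a)$ be the set of $y\in Y$ at which $\tau_a$ vanishes on the Zariski tangent space $T_y\bar Y$. Let $\operatorname{Sing}(\Phi_\Lambda)$ be the set of $x\in U$ at which the Jacobian of $\Phi_\Lambda$ has rank less than $\dim\bar Y$, let $\operatorname{Sing}(\bar Y)$ be the set of $y\in\bar Y$ with $\dim T_y\bar Y\neq\dim\bar Y$, and let $S_\Lambda=\operatorname{Sing}(\Phi_\Lambda)\cup\Phi_\Lambda^{-1}(\operatorname{Sing}(\bar Y))\subseteq U$. Then $\omega_a=\Phi_\Lambda^*(\tau_a)$ on $U$, $$\Phi_\Lambda^{-1}(V(\tau_a))\subseteq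 V(\omega_a),\qquad\text{and}\qquad V(\omega_a)-\Phi_\Lambda^{-1}(V(\tau_a))\subseteq S_\Lambda .$$ -/

import Mathlib

open scoped LinearAlgebra.Projectivization

noncomputable section

namespace MasterFunction

/-! ## Projective varieties, through homogeneous polynomials -/

/-- The homogeneous vanishing ideal of a set `Z` of points of `ℙ^q`: the ideal of
`ℂ[z₀, …, z_q]` generated by the homogeneous polynomials that vanish on `Z`. -/
def vanishingIdeal {q : ℕ} (Z : Set (ℙ ℂ (Fin (q + 1) → ℂ))) :
    Ideal (MvPolynomial (Fin (q + 1)) ℂ) :=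
  Ideal.span {P | (∃ d : ℕ, P.IsHomogeneous d) ∧ ∀ y ∈ Z, MvPolynomial.eval y.rep P = 0}

/-- The Zariski closure of a set of points of `ℙ^q`. -/
def zariskiClosure {q : ℕ} (Z : Set (ℙ ℂ (Fin (q + 1) → ℂ))) :
    Set (ℙ ℂ (Fin (q + 1) → ℂ)) :=
  {y | ∀ P ∈ vanishingIdeal Z, MvPolynomial.eval y.rep P = 0}

/-- The dimension of a nonempty projective variety: the Krull dimension of its homogeneous
coordinate ring, minus one. -/
def dimension {q : ℕ} (Z : Set (ℙ ℂ (Fin (q + 1) → ℂ))) : ℕ :=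
  ((ringKrullDim (MvPolynomial (Fin (q + 1)) ℂ ⧸ vanishingIdeal Z)).unbotD 0).toNat - 1

/-- The Zariski tangent space, at the representative `y.rep` of `y`, of the affine cone over the
projective variety `Z`: the kernel of the Jacobian matrix of generators of the ideal of `Z`.
The Zariski tangent space of `Z` itself at `y` is the quotient of this space by the line `y`. -/
def coneTangentSpace {q : ℕ} (Z : Set (ℙ ℂ (Fin (q + 1) → ℂ))) (y : ℙ ℂ (Fin (q + 1) → ℂ)) :
    Submodule ℂ (Fin (q + 1) → ℂ) :=
  ⨅ P ∈ vanishingIdeal Z, LinearMap.ker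
    (∑ j, MvPolynomial.eval y.rep (MvPolynomial.pderiv j P) •
      (LinearMap.proj j : (Fin (q + 1) → ℂ) →ₗ[ℂ] ℂ))

/-- The singular locus of an irreducible projective variety `Z`: the points at which the
Zariski tangent space of `Z` does not have the dimension of `Z`. (Passing to the affine cone
raises both dimensions by one.) -/
def singularLocus {q : ℕ} (Z : Set (ℙ ℂ (Fin (q + 1) → ℂ))) : Set (ℙ ℂ (Fin (q + 1) → ℂ)) :=
  {y | y ∈ Z ∧ Module.finrank ℂ (coneTangentSpace Z y) ≠ dimension Z + 1}

/-- The one-form `∑ aᵢ d log zᵢ` on `ℂ^{q+1}`, at the point `z`. For `∑ aᵢ = 0` it is invariant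
under scaling and vanishes on the Euler field, so it is a rational one-form on `ℙ^q`. -/
def logForm {q : ℕ} (a z : Fin (q + 1) → ℂ) : (Fin (q + 1) → ℂ) →L[ℂ] ℂ :=
  ∑ i, (a i / z i) • ContinuousLinearMap.proj i

/-- The zero locus `V(τ_a)` in `Y`, where `τ_a` is the restriction of the one-form
`∑ aᵢ d log zᵢ` of `ℙ^q` to the Zariski closure of `Y`: the points `y` of `Y` such that the form
vanishes on the Zariski tangent space at `y`. -/
def zeroLocusTau {q : ℕ} (Y : Set (ℙ ℂ (Fin (q + 1) → ℂ))) (a : Fin (q + 1) → ℂ) :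
    Set (ℙ ℂ (Fin (q + 1) → ℂ)) :=
  {y | y ∈ Y ∧ ∀ v ∈ coneTangentSpace (zariskiClosure Y) y, logForm a y.rep v = 0}

/-! ## Arrangements, logarithmic forms, master functions -/

/-- An arrangement of `n + 1` distinct hyperplanes `H_j = ker α_j` in `ℙ^ℓ`, with `α₀ = x₀`. -/
structure Arrangement (ℓ n : ℕ) where
  α : Fin (n + 1) → (Fin (ℓ + 1) → ℂ) →ₗ[ℂ] ℂ
  α_zero : α 0 = LinearMap.proj 0
  α_ne_zero : ∀ j, α j ≠ 0
  distinct : Function.Injective fun j => LinearMap.ker (α j)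

namespace Arrangement

variable {ℓ n : ℕ} (A : Arrangement ℓ n)

/-- `f_j(x₁, …, x_ℓ) = α_j(1, x₁, …, x_ℓ)`; in particular `f₀ = 1`. -/
def f (j : Fin (n + 1)) (x : Fin ℓ → ℂ) : ℂ := A.α j (Fin.cons 1 x)

/-- The complement `U` of the arrangement, inside `ℂ^ℓ = ℙ^ℓ - H₀`. -/
def U : Set (Fin ℓ → ℂ) := {x | ∀ j, A.f j x ≠ 0}

/-- Differential forms on `U`, with pointwise wedge product: functions on `U` with values in the
exterior algebra of the cotangent space. -/
abbrev Forms : Type := A.U → ExteriorAlgebra ℂ ((Fin ℓ → ℂ) →L[ℂ] ℂ)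

/-- A family of covectors on `U`, as a one-form. -/
def oneForm (θ : A.U → ((Fin ℓ → ℂ) →L[ℂ] ℂ)) : A.Forms := fun x => ExteriorAlgebra.ι ℂ (θ x)

/-- The zero locus in `U` of a differential form. -/
def V (ω : A.Forms) : Set A.U := {x | ω x = 0}

/-- `d log f_j`. -/
def dlog (j : Fin (n + 1)) : A.Forms :=
  A.oneForm fun x => (A.f j x)⁻¹ • fderiv ℂ (A.f j) x

/-- The degree one part `A¹` of the Orlik-Solomon algebra, that is, of the algebra of forms
generated by `d log f₁, …, d log f_n`. -/
def degreeOne : Submodule ℂ A.Forms := Submodule.span ℂ (Set.range fun j : Fin n => A.dlog j.succ)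

/-- `D ⊆ A¹` is a singular subspace: the multiplication map `⋀^q D → A^q` is zero for
`q = dim D`, that is, all `q`-fold products of elements of `D` vanish. -/
def IsSingularSubspace (D : Submodule ℂ A.Forms) : Prop :=
  D ≤ A.degreeOne ∧
    ∀ d : Fin (Module.finrank ℂ D) → A.Forms, (∀ i, d i ∈ D) → (List.ofFn d).prod = 0

/-- `ω_ξ = ∑_j ξ_j d log f_j`, the form `∑_j ξ_j d log α_j` in the affine chart `x₀ = 1`. -/
def omega (ξ : Fin (n + 1) → ℤ) : A.Forms := ∑ j, (ξ j : ℂ) • A.dlog j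

/-- `Λ = (ξ₁, …, ξ_q)` is an integral basis of `D`: the `ξᵢ` are integer vectors of weight zero
and the forms `ω_{ξᵢ}` are a basis of `D`. -/
def IsIntegralBasis {q : ℕ} (Λ : Fin q → Fin (n + 1) → ℤ) (D : Submodule ℂ A.Forms) : Prop :=
  (∀ i, ∑ j, Λ i j = 0) ∧ LinearIndependent ℂ (fun i => A.omega (Λ i)) ∧
    Submodule.span ℂ (Set.range fun i => A.omega (Λ i)) = D

/-- The master function `Φ_ξ = ∏_j f_j ^ ξ_j`. -/
def master (ξ : Fin (n + 1) → ℤ) (x : Fin ℓ → ℂ) : ℂ := ∏ j, A.f j x ^ ξ j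

variable {q : ℕ} (Λ : Fin q → Fin (n + 1) → ℤ)

/-- `Φ_Λ = (Φ_{ξ₁}, …, Φ_{ξ_q})` as a map to `ℂ^q`. -/
def phiAff (x : Fin ℓ → ℂ) : Fin q → ℂ := fun i => A.master (Λ i) x

/-- Homogeneous coordinates `(1, Φ_{ξ₁}, …, Φ_{ξ_q})` of `Φ_Λ`. -/
def phiHom (x : Fin ℓ → ℂ) : Fin (q + 1) → ℂ := Fin.cons 1 (A.phiAff Λ x)

theorem phiHom_ne_zero (x : Fin ℓ → ℂ) : A.phiHom Λ x ≠ 0 := fun h => by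
  simpa [phiHom] using congrFun h 0

/-- `Φ_Λ = [1 : Φ_{ξ₁} : ⋯ : Φ_{ξ_q}]` on `U`, as a map to `ℙ^q`. -/
def phi (x : A.U) : ℙ ℂ (Fin (q + 1) → ℂ) :=
  Projectivization.mk ℂ (A.phiHom Λ x) (A.phiHom_ne_zero Λ x)

/-- The image variety `Y = Φ_Λ(U)`. -/
def Y : Set (ℙ ℂ (Fin (q + 1) → ℂ)) := Set.range (A.phi Λ)

/-- The projective closure of `Y`. -/
def Ybar : Set (ℙ ℂ (Fin (q + 1) → ℂ)) := zariskiClosure (A.Y Λ)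

/-- `ω_a = ∑_{i=1}^q aᵢ ω_{ξᵢ}`. -/
def omegaA (a : Fin (q + 1) → ℂ) : A.Forms := ∑ i : Fin q, a i.succ • A.omega (Λ i)

/-- The pullback `Φ_Λ^*(τ_a)`, computed in homogeneous coordinates. -/
def pullbackTau (a : Fin (q + 1) → ℂ) : A.Forms :=
  A.oneForm fun x => (logForm a (A.phiHom Λ x)).comp (fderiv ℂ (A.phiHom Λ) x)

/-- The singular locus of `Φ_Λ`: the points of `U` where the Jacobian of `Φ_Λ` has rank less
than the dimension of the image variety. -/
def singPhi : Set A.U :=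
  {x | Module.finrank ℂ (LinearMap.range (fderiv ℂ (A.phiAff Λ) x).toLinearMap) <
    dimension (A.Ybar Λ)}

/-- `S_Λ = Sing(Φ_Λ) ∪ Φ_Λ⁻¹(Sing Ȳ)`. -/
def S : Set A.U := A.singPhi Λ ∪ A.phi Λ ⁻¹' singularLocus (A.Ybar Λ)

end Arrangement

end MasterFunction

end

open scoped LinearAlgebra.Projectivization Topology

/-! ### Scaling and differentiation of polynomial evaluations. -/

namespace MvPolynomial

/-! Everything is computed on the affine cone over `Ybar`, with the lift F = `phiHom` of the map and
T the cone tangent space at the image of x. Since dΦ_ξ = Φ_ξ ω_ξ, pulling `logForm` back along F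
gives ω_a. The range of dF_x lies in T, because polynomials in the vanishing ideal are zero along F;
so if τ_a kills T, then ω_a(x) = 0.

Conversely, T also contains the line through F(x). That line meets the range of dF_x only in 0, so
their sum has dimension rank dΦ_Λ + 1. Off `S` this is at least dim Ȳ + 1 = dim T, so the sum is all
of T (`coneTangentSpace_eq_of_notMem_S`). If ω_a(x) = 0, the form kills the first summand; it kills
F(x) because ∑ aᵢ = 0. -/

theorem IsHomogeneous.eval_smul_point {σ R : Type*} [CommSemiring R] {P : MvPolynomial σ R} {d : ℕ}
    (hP : P.IsHomogeneous d) (c : R) (z : σ → R) : eval (c • z) P = c ^ d * eval z P := by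
  rw [eval_eq, eval_eq, Finset.mul_sum]
  refine Finset.sum_congr rfl fun m hm => ?_
  have hd : ∑ i ∈ m.support, m i = d := by
    simpa [Finsupp.weight_apply, Finsupp.sum] using hP (mem_support_iff.mp hm)
  simp only [Pi.smul_apply, smul_eq_mul, mul_pow, Finset.prod_mul_distrib, Finset.prod_pow_eq_pow_sum,
    hd]
  ring

theorem hasFDerivAt_eval {σ 𝕜 : Type*} [Fintype σ] [NontriviallyNormedField 𝕜]
    (P : MvPolynomial σ 𝕜) (z : σ → 𝕜) :
    HasFDerivAt (fun w => eval w P)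
      (∑ j, eval z (pderiv j P) • (ContinuousLinearMap.proj j : (σ → 𝕜) →L[𝕜] 𝕜)) z := by
  classical
  have happ : ∀ (Q : MvPolynomial σ 𝕜) (v : σ → 𝕜),
      (∑ j, eval z (pderiv j Q) • (ContinuousLinearMap.proj j : (σ → 𝕜) →L[𝕜] 𝕜)) v =
        ∑ j, eval z (pderiv j Q) * v j := fun Q v => by simp
  induction P using MvPolynomial.induction_on with
  | C c =>
    simp only [eval_C]
    refine (hasFDerivAt_const c z).congr_fderiv (ContinuousLinearMap.ext fun v => ?_)
    simp
  | add P Q hP hQ =>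
    simp only [map_add (eval _)]
    refine (hP.add hQ).congr_fderiv (ContinuousLinearMap.ext fun v => ?_)
    rw [add_apply, happ, happ, happ]
    simp only [map_add, add_mul, Finset.sum_add_distrib]
  | mul_X P i hP =>
    simp only [map_mul, eval_X]
    refine (hP.mul (hasFDerivAt_apply i z)).congr_fderiv (ContinuousLinearMap.ext fun v => ?_)
    have hX : ∀ j, eval z (pderiv j (X i : MvPolynomial σ 𝕜)) = if i = j then 1 else 0 := fun j => by
      rw [pderiv_X, Pi.single_apply]
      split_ifs <;> simp
    rw [add_apply, smul_apply, smul_apply, happ, happ]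
    simp only [Derivation.leibniz, smul_eq_mul, map_add, map_mul, eval_X, hX, add_mul,
      Finset.sum_add_distrib, mul_ite, mul_one, mul_zero, ite_mul, zero_mul, Finset.sum_ite_eq,
      Finset.mem_univ, if_true, Finset.mul_sum, mul_assoc, ContinuousLinearMap.proj_apply]

end MvPolynomial

namespace MasterFunction

open MvPolynomial

/-! ### Tangent vectors of affine cones and the logarithmic form. -/

section Projective

variable {q : ℕ} {Z : Set (ℙ ℂ (Fin (q + 1) → ℂ))}

/-- The ideal is defined through the chosen representatives `rep`; homogeneity of its generators
frees it from that choice. -/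
theorem eval_eq_zero_of_mem_vanishingIdeal {P : MvPolynomial (Fin (q + 1)) ℂ}
    (hP : P ∈ vanishingIdeal Z) {v : Fin (q + 1) → ℂ} (hv : v ≠ 0)
    (hZ : Projectivization.mk ℂ v hv ∈ Z) : eval v P = 0 := by
  suffices h : vanishingIdeal Z ≤ RingHom.ker (eval v) from RingHom.mem_ker.mp (h hP)
  refine Ideal.span_le.mpr ?_
  rintro Q ⟨⟨d, hd⟩, hQ⟩
  obtain ⟨c, hc⟩ := Projectivization.exists_smul_eq_mk_rep ℂ v hv
  have h := hQ _ hZ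
  rw [← hc, Units.smul_def, hd.eval_smul_point] at h
  exact (mul_eq_zero.mp h).resolve_left (pow_ne_zero _ c.ne_zero)

theorem subset_zariskiClosure (Z : Set (ℙ ℂ (Fin (q + 1) → ℂ))) : Z ⊆ zariskiClosure Z := by
  intro y hy P hP
  refine eval_eq_zero_of_mem_vanishingIdeal hP y.rep_nonzero ?_
  rwa [y.mk_rep]

/-- The velocity at `x` of a map into the punctured affine cone over `Z` is tangent to the cone. -/
theorem fderiv_mem_coneTangentSpace {E : Type*} [NormedAddCommGroup E] [NormedSpace ℂ E]
    {y : ℙ ℂ (Fin (q + 1) → ℂ)} {g : E → Fin (q + 1) → ℂ} {g' : E →L[ℂ] Fin (q + 1) → ℂ} {x : E}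
    (hg : HasFDerivAt g g' x) (hx : g x = y.rep)
    (hZ : ∀ᶠ x' in 𝓝 x, ∃ h : g x' ≠ 0, Projectivization.mk ℂ (g x') h ∈ Z) (w : E) :
    g' w ∈ coneTangentSpace Z y := by
  simp only [coneTangentSpace, Submodule.mem_iInf, LinearMap.mem_ker]
  intro P hP
  have h1 := (hasFDerivAt_eval P (g x)).comp x hg
  have h2 : HasFDerivAt ((fun w => eval w P) ∘ g) (0 : E →L[ℂ] ℂ) x := by
    refine (hasFDerivAt_const (0 : ℂ) x).congr_of_eventuallyEq ?_
    filter_upwards [hZ] with x' ⟨h, hx'⟩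
    exact eval_eq_zero_of_mem_vanishingIdeal hP h hx'
  have h3 := DFunLike.congr_fun (h1.unique h2) w
  simpa [hx] using h3

theorem rep_mem_coneTangentSpace {y : ℙ ℂ (Fin (q + 1) → ℂ)} (hy : y ∈ Z) :
    y.rep ∈ coneTangentSpace Z y := by
  have hg : HasFDerivAt (fun t : ℂ => t • y.rep)
      ((ContinuousLinearMap.id ℂ ℂ).smulRight y.rep) 1 :=
    ((ContinuousLinearMap.id ℂ ℂ).smulRight y.rep).hasFDerivAt
  -- The radial path stays in the cone, with velocity `y.rep` at time 1.
  have h := fderiv_mem_coneTangentSpace (Z := Z) (y := y) hg (one_smul _ _) ?_ 1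
  · simpa using h
  · filter_upwards [isOpen_ne.mem_nhds (one_ne_zero : (1 : ℂ) ≠ 0)] with t ht
    have h0 : t • y.rep ≠ 0 := smul_ne_zero ht y.rep_nonzero
    refine ⟨h0, ?_⟩
    have : Projectivization.mk ℂ (t • y.rep) h0 = y := by
      conv_rhs => rw [← y.mk_rep]
      exact (Projectivization.mk_eq_mk_iff' ℂ _ _ _ _).mpr ⟨t, rfl⟩
    rwa [this]

theorem logForm_apply (a z v : Fin (q + 1) → ℂ) : logForm a z v = ∑ i, a i / z i * v i := by
  simp [logForm]

/-- Consequently the vanishing of the form on a subspace does not depend on the representative of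
the point. -/
theorem logForm_smul (a z : Fin (q + 1) → ℂ) (c : ℂ) : logForm a (c • z) = c⁻¹ • logForm a z := by
  refine ContinuousLinearMap.ext fun v => ?_
  simp only [smul_apply, logForm_apply, Pi.smul_apply, smul_eq_mul, Finset.mul_sum]
  refine Finset.sum_congr rfl fun i _ => ?_
  rw [div_eq_mul_inv, mul_inv, div_eq_mul_inv]
  ring

theorem logForm_self (a : Fin (q + 1) → ℂ) {z : Fin (q + 1) → ℂ} (hz : ∀ i, z i ≠ 0) :
    logForm a z z = ∑ i, a i := by
  simp [logForm_apply, hz]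

end Projective

/-! ### Derivatives of master functions, the pullback, and the rank comparison. -/

namespace Arrangement

variable {ℓ n q : ℕ} (A : Arrangement ℓ n) (Λ : Fin q → Fin (n + 1) → ℤ)

theorem differentiable_f (j : Fin (n + 1)) : Differentiable ℂ (A.f j) := by
  have h : Differentiable ℂ (fun x : Fin ℓ → ℂ => (Fin.cons 1 x : Fin (ℓ + 1) → ℂ)) := by
    refine differentiable_pi.mpr fun i => ?_
    refine Fin.cases ?_ (fun k => ?_) i
    · simp
    · simpa using differentiable_apply k
  exact (LinearMap.toContinuousLinearMap (A.α j)).differentiable.comp h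

theorem isOpen_U : IsOpen A.U := by
  simp only [U, Set.ofPred_forall]
  exact isOpen_iInter_of_finite fun j => isOpen_ne_fun (A.differentiable_f j).continuous
    continuous_const

theorem master_ne_zero (ξ : Fin (n + 1) → ℤ) {x : Fin ℓ → ℂ} (hx : x ∈ A.U) :
    A.master ξ x ≠ 0 :=
  Finset.prod_ne_zero_iff.mpr fun j _ => zpow_ne_zero _ (hx j)

theorem phiHom_apply_ne_zero {x : Fin ℓ → ℂ} (hx : x ∈ A.U) (i : Fin (q + 1)) :
    A.phiHom Λ x i ≠ 0 := by
  refine Fin.cases ?_ (fun k => ?_) i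
  · simp [phiHom]
  · simpa [phiHom, phiAff] using A.master_ne_zero (Λ k) hx

/-- The covector underlying `ω_ξ`. -/
noncomputable def omegaCovector (ξ : Fin (n + 1) → ℤ) (x : Fin ℓ → ℂ) : (Fin ℓ → ℂ) →L[ℂ] ℂ :=
  ∑ j, (ξ j : ℂ) • (A.f j x)⁻¹ • fderiv ℂ (A.f j) x

theorem omega_apply (ξ : Fin (n + 1) → ℤ) (x : A.U) :
    A.omega ξ x = ExteriorAlgebra.ι ℂ (A.omegaCovector ξ x) := by
  simp [omega, omegaCovector, dlog, oneForm]

theorem hasFDerivAt_master (ξ : Fin (n + 1) → ℤ) {x : Fin ℓ → ℂ} (hx : x ∈ A.U) :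
    HasFDerivAt (A.master ξ) (A.master ξ x • A.omegaCovector ξ x) x := by
  classical
  have h := HasFDerivAt.finsetProd (u := Finset.univ) (x := x)
    (g := fun j x => A.f j x ^ ξ j) fun j _ =>
      (hasDerivAt_zpow (ξ j) (A.f j x) (Or.inl (hx j))).comp_hasFDerivAt x
        (A.differentiable_f j x).hasFDerivAt
  refine h.congr_fderiv ?_
  rw [omegaCovector, Finset.smul_sum]
  refine Finset.sum_congr rfl fun j hj => ?_
  rw [master, ← Finset.prod_erase_mul _ _ hj, smul_smul, smul_smul, smul_smul,
    zpow_sub_one₀ (hx j)]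
  congr 1
  ring

theorem hasFDerivAt_phiAff {x : Fin ℓ → ℂ} (hx : x ∈ A.U) :
    HasFDerivAt (A.phiAff Λ)
      (ContinuousLinearMap.pi fun i => A.master (Λ i) x • A.omegaCovector (Λ i) x) x :=
  hasFDerivAt_pi.mpr fun i => A.hasFDerivAt_master (Λ i) hx

theorem hasFDerivAt_phiHom {x : Fin ℓ → ℂ} (hx : x ∈ A.U) :
    HasFDerivAt (A.phiHom Λ) (ContinuousLinearMap.pi
      (Fin.cons 0 fun i => ContinuousLinearMap.proj i ∘L fderiv ℂ (A.phiAff Λ) x)) x := by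
  refine hasFDerivAt_pi.mpr fun i => ?_
  refine Fin.cases ?_ (fun k => ?_) i
  · simpa [phiHom] using hasFDerivAt_const (1 : ℂ) x
  · rw [(A.hasFDerivAt_phiAff Λ hx).fderiv]
    simpa [phiHom, phiAff] using A.hasFDerivAt_master (Λ k) hx

theorem fderiv_phiHom_apply {x : Fin ℓ → ℂ} (hx : x ∈ A.U) (w : Fin ℓ → ℂ) :
    fderiv ℂ (A.phiHom Λ) x w = Fin.cons 0 (fderiv ℂ (A.phiAff Λ) x w) := by
  rw [(A.hasFDerivAt_phiHom Λ hx).fderiv]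
  ext i
  refine Fin.cases ?_ (fun k => ?_) i <;> simp

/-- The factors Φ_ξ in dΦ_ξ = Φ_ξ ω_ξ cancel the denominators of the form; a₀ drops out because the
first coordinate is constant. -/
theorem omegaA_eq_pullbackTau (a : Fin (q + 1) → ℂ) : A.omegaA Λ a = A.pullbackTau Λ a := by
  funext x
  have h : (logForm a (A.phiHom Λ x)).comp (fderiv ℂ (A.phiHom Λ) x) =
      ∑ i : Fin q, a i.succ • A.omegaCovector (Λ i) x := by
    refine ContinuousLinearMap.ext fun w => ?_
    rw [ContinuousLinearMap.comp_apply, A.fderiv_phiHom_apply Λ x.2,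
      (A.hasFDerivAt_phiAff Λ x.2).fderiv, logForm_apply, Fin.sum_univ_succ]
    simp only [sum_apply, smul_apply, Fin.cons_zero, Fin.cons_succ, mul_zero, zero_add,
      ContinuousLinearMap.coe_pi', phiHom, phiAff, smul_eq_mul]
    refine Finset.sum_congr rfl fun i _ => ?_
    rw [← mul_assoc, div_mul_cancel₀ _ (A.master_ne_zero (Λ i) x.2)]
  simp [pullbackTau, oneForm, h, omegaA, omega_apply]

theorem mem_V_omegaA_iff (a : Fin (q + 1) → ℂ) (x : A.U) :
    x ∈ A.V (A.omegaA Λ a) ↔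
      ∀ w, logForm a (A.phiHom Λ x) (fderiv ℂ (A.phiHom Λ) x w) = 0 := by
  rw [omegaA_eq_pullbackTau]
  simp only [V, pullbackTau, oneForm, Set.mem_ofPred_eq, ExteriorAlgebra.ι_eq_zero_iff,
    ContinuousLinearMap.ext_iff, ContinuousLinearMap.comp_apply, zero_apply]

theorem phi_mem_Ybar (x : A.U) : A.phi Λ x ∈ A.Ybar Λ :=
  subset_zariskiClosure _ ⟨x, rfl⟩

theorem fderiv_phiHom_mem_coneTangentSpace (x : A.U) (w : Fin ℓ → ℂ) :
    fderiv ℂ (A.phiHom Λ) x w ∈ coneTangentSpace (A.Ybar Λ) (A.phi Λ x) := by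
  obtain ⟨c, hc⟩ := Projectivization.exists_smul_eq_mk_rep ℂ _ (A.phiHom_ne_zero Λ x)
  rw [Units.smul_def] at hc
  -- The scalar c is fixed at x, so that c • `phiHom` passes through `rep` there and stays
  -- differentiable; `rep` itself is an arbitrary choice at each point.
  have hd := (A.hasFDerivAt_phiHom Λ x.2).differentiableAt.hasFDerivAt.const_smul (c : ℂ)
  have h := fderiv_mem_coneTangentSpace (Z := A.Ybar Λ) (y := A.phi Λ x) hd hc ?_ w
  · exact (Submodule.smul_mem_iff _ c.ne_zero).mp h
  · filter_upwards [A.isOpen_U.mem_nhds x.2] with x' hx'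
    have h0 : (c : ℂ) • A.phiHom Λ x' ≠ 0 := smul_ne_zero c.ne_zero (A.phiHom_ne_zero Λ x')
    refine ⟨h0, ?_⟩
    have : Projectivization.mk ℂ ((c : ℂ) • A.phiHom Λ x') h0 = A.phi Λ ⟨x', hx'⟩ :=
      (Projectivization.mk_eq_mk_iff' ℂ _ _ _ _).mpr ⟨c, rfl⟩
    change Projectivization.mk ℂ ((c : ℂ) • A.phiHom Λ x') h0 ∈ _
    rw [this]
    exact A.phi_mem_Ybar Λ _

theorem phiHom_mem_coneTangentSpace (x : A.U) :
    A.phiHom Λ x ∈ coneTangentSpace (A.Ybar Λ) (A.phi Λ x) := by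
  obtain ⟨c, hc⟩ := Projectivization.exists_smul_eq_mk_rep ℂ _ (A.phiHom_ne_zero Λ x)
  have h := rep_mem_coneTangentSpace (A.phi_mem_Ybar Λ x)
  rw [phi, ← hc, Units.smul_def] at h
  exact (Submodule.smul_mem_iff _ c.ne_zero).mp h

/-- The rank of the differential of `Φ_Λ` grows by one on passing to the affine cone. -/
theorem finrank_range_fderiv_phiHom_sup (x : A.U) :
    Module.finrank ℂ (LinearMap.range (fderiv ℂ (A.phiHom Λ) x).toLinearMap ⊔
        Submodule.span ℂ {A.phiHom Λ x} : Submodule ℂ (Fin (q + 1) → ℂ)) =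
      Module.finrank ℂ (LinearMap.range (fderiv ℂ (A.phiAff Λ) x).toLinearMap) + 1 := by
  have hdisj : LinearMap.range (fderiv ℂ (A.phiHom Λ) x).toLinearMap ⊓
      Submodule.span ℂ {A.phiHom Λ x} = ⊥ := by
    rw [eq_bot_iff]
    rintro _ ⟨⟨w, rfl⟩, hw⟩
    obtain ⟨c, hc⟩ := Submodule.mem_span_singleton.mp hw
    -- Vectors in the range of the differential have first coordinate 0, while `phiHom` has first
    -- coordinate 1.
    have h0 := congrFun hc 0
    simp only [ContinuousLinearMap.coe_coe, A.fderiv_phiHom_apply Λ x.2, phiHom, Pi.smul_apply,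
      Fin.cons_zero, smul_eq_mul, mul_one] at h0
    rw [← hc, h0, zero_smul]
    exact zero_mem _
  let e : (Fin q → ℂ) →ₗ[ℂ] Fin (q + 1) → ℂ :=
    LinearMap.pi (Fin.cons 0 fun i => LinearMap.proj i)
  have he : ∀ v, e v = Fin.cons 0 v := fun v => by
    ext i
    refine Fin.cases ?_ (fun k => ?_) i <;> simp [e]
  have hinj : Function.Injective e := fun v w h => by
    rw [he, he] at h
    exact Fin.cons_right_injective _ h
  have hcomp : (fderiv ℂ (A.phiHom Λ) x).toLinearMap =
      e ∘ₗ (fderiv ℂ (A.phiAff Λ) x).toLinearMap := by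
    refine LinearMap.ext fun w => ?_
    simp [he, A.fderiv_phiHom_apply Λ x.2]
  have hrank : Module.finrank ℂ (LinearMap.range (fderiv ℂ (A.phiHom Λ) x).toLinearMap) =
      Module.finrank ℂ (LinearMap.range (fderiv ℂ (A.phiAff Λ) x).toLinearMap) := by
    rw [hcomp, LinearMap.range_comp]
    exact (Submodule.equivMapOfInjective e hinj _).finrank_eq.symm
  have h := Submodule.finrank_sup_add_finrank_inf_eq
    (LinearMap.range (fderiv ℂ (A.phiHom Λ) x).toLinearMap) (Submodule.span ℂ {A.phiHom Λ x})
  rwa [hdisj, finrank_bot, add_zero, hrank,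
    finrank_span_singleton (A.phiHom_ne_zero Λ x)] at h

theorem coneTangentSpace_eq_of_notMem_S {x : A.U} (hx : x ∉ A.S Λ) :
    LinearMap.range (fderiv ℂ (A.phiHom Λ) x).toLinearMap ⊔ Submodule.span ℂ {A.phiHom Λ x} =
      coneTangentSpace (A.Ybar Λ) (A.phi Λ x) := by
  have h1 : dimension (A.Ybar Λ) ≤
      Module.finrank ℂ (LinearMap.range (fderiv ℂ (A.phiAff Λ) x).toLinearMap) :=
    not_lt.mp fun h => hx (Or.inl h)
  have h2 : Module.finrank ℂ (coneTangentSpace (A.Ybar Λ) (A.phi Λ x)) =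
      dimension (A.Ybar Λ) + 1 :=
    not_not.mp fun h => hx (Or.inr ⟨A.phi_mem_Ybar Λ x, h⟩)
  refine Submodule.eq_of_le_of_finrank_le (sup_le ?_ ?_) ?_
  · rintro _ ⟨w, rfl⟩
    exact A.fderiv_phiHom_mem_coneTangentSpace Λ x w
  · exact (Submodule.span_singleton_le_iff_mem _ _).mpr (A.phiHom_mem_coneTangentSpace Λ x)
  · rw [h2, A.finrank_range_fderiv_phiHom_sup Λ x]
    exact Nat.succ_le_succ h1

theorem phi_mem_zeroLocusTau_iff (a : Fin (q + 1) → ℂ) (x : A.U) :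
    A.phi Λ x ∈ zeroLocusTau (A.Y Λ) a ↔
      ∀ v ∈ coneTangentSpace (A.Ybar Λ) (A.phi Λ x), logForm a (A.phiHom Λ x) v = 0 := by
  obtain ⟨c, hc⟩ := Projectivization.exists_smul_eq_mk_rep ℂ _ (A.phiHom_ne_zero Λ x)
  have hrep : (A.phi Λ x).rep = (c : ℂ) • A.phiHom Λ x := hc.symm
  have hY : A.phi Λ x ∈ A.Y Λ := ⟨x, rfl⟩
  simp only [zeroLocusTau, Set.mem_ofPred_eq, hY, true_and, hrep, logForm_smul,
    smul_apply, smul_eq_mul, mul_eq_zero, inv_eq_zero, c.ne_zero, false_or, Ybar]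

end Arrangement

end MasterFunction

theorem mainTheorem4 {ℓ n q : ℕ} (A : MasterFunction.Arrangement ℓ n)
    (D : Submodule ℂ A.Forms) (hD : A.IsSingularSubspace D)
    (Λ : Fin q → Fin (n + 1) → ℤ) (hΛ : A.IsIntegralBasis Λ D)
    (a : Fin (q + 1) → ℂ) (ha : ∑ i, a i = 0) :
    A.omegaA Λ a = A.pullbackTau Λ a ∧
    A.phi Λ ⁻¹' MasterFunction.zeroLocusTau (A.Y Λ) a ⊆ A.V (A.omegaA Λ a) ∧
    A.V (A.omegaA Λ a) \ A.phi Λ ⁻¹' MasterFunction.zeroLocusTau (A.Y Λ) a ⊆ A.S Λ := by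
  refine ⟨A.omegaA_eq_pullbackTau Λ a, fun x hx => ?_, fun x hx => ?_⟩
  · rw [Set.mem_preimage, A.phi_mem_zeroLocusTau_iff] at hx
    exact (A.mem_V_omegaA_iff Λ a x).mpr fun w => hx _ (A.fderiv_phiHom_mem_coneTangentSpace Λ x w)
  · by_contra hS
    have hV := (A.mem_V_omegaA_iff Λ a x).mp hx.1
    refine hx.2 ((A.phi_mem_zeroLocusTau_iff Λ a x).mpr fun v hv => ?_)
    rw [← A.coneTangentSpace_eq_of_notMem_S Λ hS] at hv
    obtain ⟨_, ⟨w, rfl⟩, u, hu, rfl⟩ := Submodule.mem_sup.mp hv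
    obtain ⟨c, rfl⟩ := Submodule.mem_span_singleton.mp hu
    -- On the Euler direction F(x) the form takes the value ∑ aᵢ = 0.
    rw [map_add, map_smul, MasterFunction.logForm_self a (A.phiHom_apply_ne_zero Λ x.2), ha,
      smul_zero, add_zero]
    exact hV w
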